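/- Let $R$ be an associative ring with identity, let $n\ge 1$ be an integer and let $d\in\{1,2,3,\dots\}\cup\{\infty\}$. All modules are left $R$-modules. A module $M$ is finitely $n$-presented if there is an exact sequence $F_n\to F_{n-1}\to\cdots\to F_0\to M\to 0$ with all $F_i$ finitely generated projective. Let $\mathsf{FP}_n^{\le d}(R)$ be the class of finitely $n$-presented modules of projective dimension at most $d$ (no condition on the projective dimension if $d=\infty$). A module $E$ is $\mathsf{FP}_n^{\le d}$-injective if $\operatorname{Ext}^1_R(K,E)=0$ for all $K\in\mathsf{FP}_n^{\le d}(R)$, and a module $P$ is $\mathsf{FP}_n^{\le d}$-projective if $\operatorname{Ext}^1_R(P,E)=0$ for all $\mathsf{FP}_n^{\le d}$-injective modules $E$. The ring $R$ is left $(n,d)$-coherent if every module in $\mathsf{FP}_n^{\le d}(R)$ is finitely $(n+1)$-presented. Suppose that $R$ is left $(n,d)$-coherent, and consider the following conditions: - (a) every $\mathsf{FP}_n^{\le d}$-projective module is $\mathsf{FP}_n^{\le d}$-injective; - (b) every module is $\mathsf{FP}_n^{\le d}$-injective; - (c) $\operatorname{Ext}^1_R(X,Y)=0$ for all $\mathsf{FP}_n^{\le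 d}$-projective modules $X$ and $Y$; - (d) the $\mathsf{FP}_n^{\le d}$-projective modules are exactly the projective modules; - (e) $\mathsf{FP}_n^{\le d}(R)$ is exactly the class of finitely generated projective modules; - (f) for every finitely generated proper right ideal $I$ of $R$, the left annihilator $\{r\in R : rx=0 \text{ for all } x\in I\}$ is nonzero. If $d<\infty$, then (a), (b), (c), (d), (e) and (f) are equivalent. If $d=\infty$, then (a), (b), (c), (d) and (e) are equivalent, and they imply (f). -/

import Mathlib

open CategoryTheory

universe u

namespace BoundedFP

/-- `M` is finitely `n`-presented: there is an exact sequence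
`F n ⟶ F (n-1) ⟶ ⋯ ⟶ F 1 ⟶ F 0 ⟶ M ⟶ 0` with `F i` finitely generated projective for all `i ≤ n`.
Here `δ i : F (i + 1) → F i` and `ε : F 0 → M`. Exactness is required at `M`, at `F 0` (if `1 ≤ n`)
and at `F (i + 1)` for `i + 2 ≤ n`; the terms beyond index `n` are irrelevant. -/
def finitelyPresented (R : Type u) [Ring R] (n : ℕ) : ObjectProperty (ModuleCat.{u} R) :=
  fun M => ∃ (F : ℕ → ModuleCat.{u} R) (δ : ∀ i : ℕ, F (i + 1) →ₗ[R] F i) (ε : F 0 →ₗ[R] M),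
    (∀ i ≤ n, Module.Finite R (F i) ∧ Module.Projective R (F i)) ∧
    Function.Surjective ε ∧
    (1 ≤ n → Function.Exact (δ 0) ε) ∧
    (∀ i, i + 2 ≤ n → Function.Exact (δ (i + 1)) (δ i))

/-- Modules of projective dimension at most `d`; for `d = ⊤` these are all modules. -/
def projDimLE (R : Type u) [Ring R] (d : ℕ∞) : ObjectProperty (ModuleCat.{u} R) :=
  fun M => projectiveDimension M ≤ (d : WithBot ℕ∞)

/-- The class of finitely `n`-presented modules of projective dimension at most `d`. -/
def FP (R : Type u) [Ring R] (n : ℕ) (d : ℕ∞) : ObjectProperty (ModuleCat.{u} R) :=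
  fun M => finitelyPresented R n M ∧ projDimLE R d M

/-- `R` is left `(n,d)`-coherent: every finitely `n`-presented left module of projective dimension
at most `d` is finitely `(n+1)`-presented. -/
def IsLeftCoherent (R : Type u) [Ring R] (n : ℕ) (d : ℕ∞) : Prop :=
  FP R n d ≤ finitelyPresented R (n + 1)

/-- The modules `E` with `Ext¹(X, E) = 0` for all `X` in the class. -/
def rightPerp {R : Type u} [Ring R] (𝒳 : ObjectProperty (ModuleCat.{u} R)) :
    ObjectProperty (ModuleCat.{u} R) :=
  fun E => ∀ X, 𝒳 X → Subsingleton (Abelian.Ext.{u} X E 1)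

/-- The modules `P` with `Ext¹(P, Y) = 0` for all `Y` in the class. -/
def leftPerp {R : Type u} [Ring R] (𝒴 : ObjectProperty (ModuleCat.{u} R)) :
    ObjectProperty (ModuleCat.{u} R) :=
  fun P => ∀ Y, 𝒴 Y → Subsingleton (Abelian.Ext.{u} P Y 1)

/-- The class of injective modules relative to `FP R n d`. -/
def FPInj (R : Type u) [Ring R] (n : ℕ) (d : ℕ∞) : ObjectProperty (ModuleCat.{u} R) :=
  rightPerp (FP R n d)

/-- The class of projective modules relative to `FP R n d`. -/
def FPProj (R : Type u) [Ring R] (n : ℕ) (d : ℕ∞) : ObjectProperty (ModuleCat.{u} R) :=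
  leftPerp (FPInj R n d)

/-- The class of all projective modules. -/
def bigProj (R : Type u) [Ring R] : ObjectProperty (ModuleCat.{u} R) :=
  fun M => Module.Projective R M

/-- The class of finitely generated projective modules. -/
def smallProj (R : Type u) [Ring R] : ObjectProperty (ModuleCat.{u} R) :=
  fun M => Module.Finite R M ∧ Module.Projective R M

/-- The left annihilator `{r | r x = 0 for all x ∈ I}` of a right ideal `I` of `R`, where right
ideals of `R` are left ideals of `Rᵐᵒᵖ`. -/
def leftAnnihilator {R : Type u} [Ring R] (I : Ideal Rᵐᵒᵖ) : Ideal R where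
  carrier := {r | ∀ x ∈ I, r * x.unop = 0}
  add_mem' := fun ha hb x hx => by rw [add_mul, ha x hx, hb x hx, add_zero]
  zero_mem' := fun x _ => zero_mul _
  smul_mem' := fun c a ha x hx => by rw [smul_eq_mul, mul_assoc, ha x hx, mul_zero]

/-- The left annihilator of every finitely generated proper right ideal is nonzero. -/
def AnnihilatorCondition (R : Type u) [Ring R] : Prop :=
  ∀ I : Ideal Rᵐᵒᵖ, I.FG → I ≠ ⊤ → leftAnnihilator I ≠ ⊥

end BoundedFP

namespace BoundedFP

/-! Everything is compared with (e), which says that each `K` in `FP R n d` is projective. Since `FP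
≤ FPProj`, the links (a)⇔(c) and (b)⇔(d)⇔(e) are formal. For (a)⇒(e), coherence puts the syzygy of
`K` in `FP` again, so (a) kills the class of `0 → ker p → P → K → 0` and `K` is a summand of `P`
(`exists_syzygy`, `projective_of_subsingleton_ext_ker`). For (e)⇒(f), generators `x i` of a right
ideal with zero left annihilator give an embedding `R → R^m` whose cokernel lies in `FP`; it splits,
and the retraction expresses `1` through the `x i`. Conversely, (f) makes every embedding of
finitely generated projectives split (`splitsIntoProjectives_of_annihilator`), so for finite `d` the
projective dimension of `K` can be lowered step by step to `0`. -/

variable {R : Type u} [Ring R]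

/-! ### Embeddings between finitely generated projectives under (f) -/

/-- The injections of `M` into finitely generated projective modules split. -/
def SplitsIntoProjectives (R : Type u) [Ring R] (M : Type u) [AddCommGroup M] [Module R M] :
    Prop :=
  ∀ (P : Type u) [AddCommGroup P] [Module R P] [Module.Finite R P] [Module.Projective R P]
    (f : M →ₗ[R] P), Function.Injective f → ∃ g : P →ₗ[R] M, g ∘ₗ f = LinearMap.id

theorem SplitsIntoProjectives.congr {M N : Type u} [AddCommGroup M] [Module R M]
    [AddCommGroup N] [Module R N] (e : M ≃ₗ[R] N) (h : SplitsIntoProjectives R M) :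
    SplitsIntoProjectives R N := by
  intro P _ _ _ _ f hf
  obtain ⟨g, hg⟩ := h P (f ∘ₗ e.toLinearMap) (hf.comp e.injective)
  refine ⟨e.toLinearMap ∘ₗ g, LinearMap.ext fun x => ?_⟩
  have := LinearMap.congr_fun hg (e.symm x)
  simp only [LinearMap.comp_apply, LinearEquiv.coe_coe, LinearEquiv.apply_symm_apply,
    LinearMap.id_apply] at this ⊢
  rw [this, LinearEquiv.apply_symm_apply]

/-- Split off `N` first: `P` is the direct sum of the image of `N` and `ker ρ`. Then `M` embeds in
`ker ρ`, which is again finitely generated projective. -/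
theorem SplitsIntoProjectives.prod {M N : Type u} [AddCommGroup M] [Module R M]
    [AddCommGroup N] [Module R N] (hM : SplitsIntoProjectives R M)
    (hN : SplitsIntoProjectives R N) : SplitsIntoProjectives R (M × N) := by
  intro P _ _ _ _ f hf
  obtain ⟨ρ, hρ⟩ := hN P (f ∘ₗ LinearMap.inr R M N) (hf.comp LinearMap.inr_injective)
  replace hρ : ∀ y, ρ (f (0, y)) = y := fun y => LinearMap.congr_fun hρ y
  let π : P →ₗ[R] LinearMap.ker ρ :=
    (LinearMap.id - f ∘ₗ LinearMap.inr R M N ∘ₗ ρ).codRestrict _ fun p => by simp [hρ]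
  have hπ : ∀ p, (π p : P) = p - f (0, ρ p) := fun p => rfl
  have hs : π ∘ₗ (LinearMap.ker ρ).subtype = LinearMap.id :=
    LinearMap.ext fun x => Subtype.ext <| by
      have hx : ρ x = 0 := x.2
      have h0 : f (0, 0) = 0 := map_zero f
      simp [hπ, hx, h0]
  have : Module.Projective R (LinearMap.ker ρ) := .of_split _ π hs
  have : Module.Finite R (LinearMap.ker ρ) :=
    .of_surjective π fun x => ⟨x, LinearMap.congr_fun hs x⟩
  obtain ⟨h, hh⟩ := hM (LinearMap.ker ρ) (π ∘ₗ f ∘ₗ LinearMap.inl R M N) <| by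
    refine (injective_iff_map_eq_zero _).2 fun x hx => ?_
    have h1 : f (x, 0) - f (0, ρ (f (x, 0))) = 0 := congrArg Subtype.val hx
    exact congrArg Prod.fst (hf (sub_eq_zero.1 h1))
  replace hh : ∀ x, h (π (f (x, 0))) = x := fun x => LinearMap.congr_fun hh x
  have hπ0 : ∀ y, π (f (0, y)) = 0 := fun y => Subtype.ext <| by simp [hπ, hρ]
  -- `ρ` need not vanish on the image of `M`, so the `M`-component is subtracted before `ρ` is
  -- applied.
  refine ⟨(h ∘ₗ π).prod (ρ ∘ₗ (LinearMap.id - f ∘ₗ LinearMap.inl R M N ∘ₗ h ∘ₗ π)),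
    LinearMap.ext fun ⟨x, y⟩ => ?_⟩
  have hxy : f (x, y) = f (x, 0) + f (0, y) := by rw [← map_add]; simp
  have h2 : h (π (f (x, y))) = x := by rw [hxy, map_add, hπ0, add_zero, hh]
  refine Prod.ext h2 ?_
  change ρ (f (x, y) - f (h (π (f (x, y))), 0)) = y
  rw [h2, hxy, add_sub_cancel_left, hρ]

theorem SplitsIntoProjectives.of_prod {M N : Type u} [AddCommGroup M] [Module R M]
    [AddCommGroup N] [Module R N] [Module.Finite R N] [Module.Projective R N]
    (h : SplitsIntoProjectives R (M × N)) : SplitsIntoProjectives R M := by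
  intro P _ _ _ _ f hf
  obtain ⟨g, hg⟩ := h (P × N) (f.prodMap LinearMap.id) (hf.prodMap Function.injective_id)
  refine ⟨LinearMap.fst R M N ∘ₗ g ∘ₗ LinearMap.inl R P N, LinearMap.ext fun x => ?_⟩
  have := congrArg Prod.fst (LinearMap.congr_fun hg (x, 0))
  simpa using this

theorem exists_sum_mul_eq_one_of_annihilator (h : AnnihilatorCondition R) {m : ℕ}
    (x : Fin m → R) (hx : ∀ r : R, (∀ i, r * x i = 0) → r = 0) :
    ∃ y : Fin m → R, ∑ i, x i * y i = 1 := by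
  let I : Ideal Rᵐᵒᵖ := Ideal.span (Set.range fun i => MulOpposite.op (x i))
  have hI : I = ⊤ := by
    by_contra hne
    refine h I (Submodule.fg_span (Set.finite_range _)) hne ?_
    refine (Submodule.eq_bot_iff _).2 fun r hr => hx r fun i => ?_
    exact hr (MulOpposite.op (x i)) (Ideal.subset_span ⟨i, rfl⟩)
  have h1 : (1 : Rᵐᵒᵖ) ∈ I := hI ▸ Submodule.mem_top
  obtain ⟨c, hc⟩ := (Submodule.mem_span_range_iff_exists_fun _).1 h1
  refine ⟨fun i => (c i).unop, ?_⟩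
  simpa using congrArg MulOpposite.unop hc

/-- With `P` a summand of `R^m`, injectivity of `f` says that the coordinates of `f 1` have zero
common left annihilator. By (f) they generate `R` as a right ideal, and the resulting coefficients
define the retraction. -/
theorem splitsIntoProjectives_self (h : AnnihilatorCondition R) :
    SplitsIntoProjectives R R := by
  intro P _ _ _ _ f hf
  obtain ⟨m, p, hp⟩ := Module.Finite.exists_fin' R P
  obtain ⟨s, hs⟩ := Module.projective_lifting_property p LinearMap.id hp
  replace hs : ∀ z, p (s z) = z := fun z => LinearMap.congr_fun hs z
  have hlin : ∀ r : R, f r = r • f 1 := fun r => by rw [← map_smul, smul_eq_mul, mul_one]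
  obtain ⟨y, hy⟩ := exists_sum_mul_eq_one_of_annihilator h (s (f 1)) fun r hr => by
    refine hf ?_
    have : s (f r) = 0 := by
      rw [hlin, map_smul]
      exact funext hr
    rw [map_zero, ← hs (f r), this, map_zero]
  refine ⟨Fintype.linearCombination R y ∘ₗ s, LinearMap.ext_ring ?_⟩
  simpa [Fintype.linearCombination_apply] using hy

theorem splitsIntoProjectives_fin (h : AnnihilatorCondition R) (k : ℕ) :
    SplitsIntoProjectives R (Fin k → R) := by
  induction k with
  | zero => exact fun P _ _ _ _ f _ => ⟨0, Subsingleton.elim _ _⟩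
  | succ k ih =>
    exact ((splitsIntoProjectives_self h).prod ih).congr (Fin.consLinearEquiv R fun _ => R)

/-- `M` has a finitely generated projective complement in some `R^k`, which `of_prod` cancels. -/
theorem splitsIntoProjectives_of_annihilator (h : AnnihilatorCondition R) (M : Type u)
    [AddCommGroup M] [Module R M] [Module.Finite R M] [Module.Projective R M] :
    SplitsIntoProjectives R M := by
  obtain ⟨k, p, hp⟩ := Module.Finite.exists_fin' R M
  obtain ⟨s, hs⟩ := Module.projective_lifting_property p LinearMap.id hp
  replace hs : ∀ z, p (s z) = z := fun z => LinearMap.congr_fun hs z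
  let π : (Fin k → R) →ₗ[R] LinearMap.ker p :=
    (LinearMap.id - s ∘ₗ p).codRestrict _ fun v => by simp [hs]
  have hπ : π ∘ₗ (LinearMap.ker p).subtype = LinearMap.id :=
    LinearMap.ext fun v => Subtype.ext <| by
      have hv : p v = 0 := v.2
      simp [π, hv]
  have : Module.Projective R (LinearMap.ker p) := .of_split _ π hπ
  have : Module.Finite R (LinearMap.ker p) :=
    .of_surjective π fun v => ⟨v, LinearMap.congr_fun hπ v⟩
  have hπs : ∀ z, π (s z) = 0 := fun z => Subtype.ext <| by simp [π, hs]
  let e : (Fin k → R) ≃ₗ[R] M × LinearMap.ker p :=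
    LinearEquiv.ofLinearMap (p.prod π) (s.coprod (LinearMap.ker p).subtype)
      (LinearMap.ext fun ⟨z, v⟩ => by
        have hv : p v = 0 := v.2
        have hv' : π v = v := LinearMap.congr_fun hπ v
        simp [hs, hπs, hv, hv'])
      (LinearMap.ext fun v => by simp [π])
  exact ((splitsIntoProjectives_fin h k).congr e).of_prod

/-! ### Syzygies and finite presentations -/

theorem projDimLE_natCast_iff (m : ℕ) (M : ModuleCat.{u} R) :
    projDimLE R m M ↔ HasProjectiveDimensionLE M m :=
  projectiveDimension_le_iff M m

theorem projective_iff (M : ModuleCat.{u} R) : Module.Projective R M ↔ Projective M :=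
  IsProjective.iff_projective M

theorem hasProjectiveDimensionLE_ker {M P : ModuleCat.{u} R} [Module.Projective R P]
    (p : P →ₗ[R] M) (hp : Function.Surjective p) (m : ℕ) [HasProjectiveDimensionLE M (m + 1)] :
    HasProjectiveDimensionLE (ModuleCat.of R (LinearMap.ker p)) m := by
  have : Projective P := (projective_iff P).1 inferInstance
  exact ((LinearMap.shortExact_shortComplexKer hp).hasProjectiveDimensionLT_X₃_iff m this).1 ‹_›

theorem projDimLE_ker {d : ℕ∞} {M P : ModuleCat.{u} R} [Module.Projective R P]
    (p : P →ₗ[R] M) (hp : Function.Surjective p) (h : projDimLE R d M) :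
    projDimLE R d (ModuleCat.of R (LinearMap.ker p)) := by
  induction d with
  | top => exact le_top
  | coe m =>
    rw [projDimLE_natCast_iff] at h ⊢
    -- Weakening the bound first makes the shift return `m` itself, which also covers `m = 0`.
    have : HasProjectiveDimensionLE M (m + 1) := hasProjectiveDimensionLT_of_ge M (m + 1) _ (by lia)
    have := hasProjectiveDimensionLE_ker p hp m
    infer_instance

/-- Over a coherent ring, a module in `FP R n d` is the quotient of a finitely generated
projective module by a module that is again in `FP R n d`. -/
theorem exists_syzygy {n : ℕ} {d : ℕ∞} (hR : IsLeftCoherent R n d) {K : ModuleCat.{u} R}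
    (hK : FP R n d K) :
    ∃ (P : ModuleCat.{u} R) (p : P →ₗ[R] K), Module.Finite R P ∧ Module.Projective R P ∧
      Function.Surjective p ∧ FP R n d (ModuleCat.of R (LinearMap.ker p)) := by
  obtain ⟨F, δ, ε, hF, hε, h0, h1⟩ := hR K hK
  have hex := h0 (by lia)
  have := (hF 0 (by lia)).2
  refine ⟨F 0, ε, (hF 0 (by lia)).1, this, hε, ?_, projDimLE_ker ε hε hK.2⟩
  -- Dropping `F 0` costs one term, and coherence has supplied one extra.
  refine ⟨fun i => F (i + 1), fun i => δ (i + 1),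
    (δ 0).codRestrict (LinearMap.ker ε) hex.apply_apply_eq_zero,
    fun i hi => hF (i + 1) (by lia), fun x => ?_, fun hn y => ?_, fun i hi => h1 (i + 1) (by lia)⟩
  · obtain ⟨y, hy⟩ := (hex x).1 x.2
    exact ⟨y, Subtype.ext hy⟩
  · rw [← h1 0 (by lia) y]
    exact Subtype.ext_iff

/-- The length-one resolution is padded with zero modules, so any `n` is reached. -/
theorem finitelyPresented_of_exact (n : ℕ) {A B C : ModuleCat.{u} R} [Module.Finite R A]
    [Module.Projective R A] [Module.Finite R B] [Module.Projective R B]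
    (f : A →ₗ[R] B) (g : B →ₗ[R] C) (hf : Function.Injective f) (hfg : Function.Exact f g)
    (hg : Function.Surjective g) : finitelyPresented R n C := by
  let F : ℕ → ModuleCat.{u} R := fun i => match i with
    | 0 => B
    | 1 => A
    | _ + 2 => ModuleCat.of R PUnit
  let δ : ∀ i, F (i + 1) →ₗ[R] F i := fun i => match i with
    | 0 => f
    | _ + 1 => 0
  refine ⟨F, δ, g, fun i _ => ?_, hg, fun _ => hfg, fun i _ => ?_⟩
  · match i with
    | 0 => exact ⟨‹Module.Finite R B›, ‹Module.Projective R B›⟩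
    | 1 => exact ⟨‹Module.Finite R A›, ‹Module.Projective R A›⟩
    | _ + 2 => exact ⟨inferInstanceAs (Module.Finite R PUnit.{u+1}),
        inferInstanceAs (Module.Projective R PUnit.{u+1})⟩
  · match i with
    | 0 =>
      intro x
      change f x = 0 ↔ x ∈ Set.range (0 : PUnit.{u+1} →ₗ[R] A)
      rw [map_eq_zero_iff f hf]
      simp [eq_comm]
    | _ + 1 => exact fun x => ⟨fun _ => ⟨0, Subsingleton.elim (α := PUnit.{u+1}) _ _⟩,
        fun _ => rfl⟩

theorem smallProj_le_FP (R : Type u) [Ring R] (n : ℕ) (d : ℕ∞) : smallProj R ≤ FP R n d := by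
  rintro M ⟨_, _⟩
  constructor
  · exact finitelyPresented_of_exact n (A := ModuleCat.of R PUnit) (0 : PUnit.{u+1} →ₗ[R] M)
      LinearMap.id (Function.injective_of_subsingleton _)
      (fun x => by simp [eq_comm]) Function.surjective_id
  · have : Projective M := (projective_iff M).1 inferInstance
    have h0 : projectiveDimension M ≤ (0 : ℕ) := (projectiveDimension_le_iff M 0).2
      ((projective_iff_hasProjectiveDimensionLE_zero M).1 this)
    exact h0.trans (WithBot.coe_le_coe.2 bot_le)

theorem finite_of_FP {n : ℕ} {d : ℕ∞} {K : ModuleCat.{u} R} (hK : FP R n d K) :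
    Module.Finite R K := by
  obtain ⟨⟨F, δ, ε, hF, hε, -⟩, -⟩ := hK
  have := (hF 0 (by lia)).1
  exact .of_surjective ε hε

/-! ### Conditions (a) to (e) through vanishing of Ext -/

theorem smallProj_eq_FP_iff {n : ℕ} {d : ℕ∞} :
    smallProj R = FP R n d ↔ ∀ K, FP R n d K → Module.Projective R K := by
  constructor
  · intro h K hK
    rw [← h] at hK
    exact hK.2
  · exact fun h => le_antisymm (smallProj_le_FP R n d) fun K hK => ⟨finite_of_FP hK, h K hK⟩

theorem projective_iff_subsingleton_ext (M : ModuleCat.{u} R) :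
    Module.Projective R M ↔ ∀ Y : ModuleCat.{u} R, Subsingleton (Abelian.Ext.{u} M Y 1) := by
  rw [projective_iff, projective_iff_subsingleton_ext_one]

theorem FPInj_eq_top_iff {n : ℕ} {d : ℕ∞} :
    FPInj R n d = ⊤ ↔ smallProj R = FP R n d := by
  rw [smallProj_eq_FP_iff, eq_top_iff]
  simp only [projective_iff_subsingleton_ext]
  exact ⟨fun h K hK Y => h Y trivial K hK, fun h Y _ K hK => h K hK Y⟩

theorem FP_le_FPProj (R : Type u) [Ring R] (n : ℕ) (d : ℕ∞) : FP R n d ≤ FPProj R n d :=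
  fun K hK _ hE => hE K hK

theorem FPProj_le_FPInj_iff {n : ℕ} {d : ℕ∞} :
    FPProj R n d ≤ FPInj R n d ↔ ∀ X Y : ModuleCat.{u} R, FPProj R n d X → FPProj R n d Y →
        Subsingleton (Abelian.Ext.{u} X Y 1) :=
  ⟨fun h _ Y hX hY => hX Y (h Y hY), fun h Y hY K hK => h K Y (FP_le_FPProj R n d K hK) hY⟩

theorem bigProj_eq_FPProj_iff {n : ℕ} {d : ℕ∞} :
    bigProj R = FPProj R n d ↔ FPInj R n d = ⊤ := by
  constructor
  · intro h
    rw [FPInj_eq_top_iff, smallProj_eq_FP_iff]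
    intro K hK
    have := FP_le_FPProj R n d K hK
    rwa [← h] at this
  · intro h
    ext M
    refine (projective_iff_subsingleton_ext M).trans ⟨fun hM Y _ => hM Y, fun hM Y => hM Y ?_⟩
    rw [h]
    trivial

theorem projective_of_subsingleton_ext_ker {K P : ModuleCat.{u} R} [Module.Projective R P]
    (p : P →ₗ[R] K) (hp : Function.Surjective p)
    (h : Subsingleton (Abelian.Ext.{u} K (ModuleCat.of R (LinearMap.ker p)) 1)) :
    Module.Projective R K := by
  -- The obstruction to lifting `𝟙 K` along `p` lies in the vanishing group `Ext¹(K, ker p)`.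
  obtain ⟨φ, hφ⟩ := Abelian.Ext.covariant_sequence_exact₃ K (LinearMap.shortExact_shortComplexKer hp)
    (Abelian.Ext.mk₀ (𝟙 K)) (zero_add 1) (Subsingleton.elim (h := h) _ _)
  obtain ⟨φ, rfl⟩ := Abelian.Ext.homEquiv₀.symm.surjective φ
  have hs : φ ≫ ModuleCat.ofHom p = 𝟙 K :=
    Abelian.Ext.homEquiv₀.symm.injective (by simpa using hφ)
  exact .of_split φ.hom p (congrArg ModuleCat.Hom.hom hs)

theorem smallProj_eq_FP_of_FPProj_le_FPInj {n : ℕ} {d : ℕ∞} (hR : IsLeftCoherent R n d)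
    (h : FPProj R n d ≤ FPInj R n d) : smallProj R = FP R n d := by
  refine smallProj_eq_FP_iff.2 fun K hK => ?_
  obtain ⟨P, p, _, _, hp, hker⟩ := exists_syzygy hR hK
  exact projective_of_subsingleton_ext_ker p hp (h _ (FP_le_FPProj R n d _ hker) K hK)

/-! ### The annihilator condition (f) against (e) -/

theorem annihilatorCondition_of_smallProj_eq_FP {n : ℕ} {d : ℕ∞} (hd : 1 ≤ d)
    (h : smallProj R = FP R n d) : AnnihilatorCondition R := by
  intro I hI hne hann
  obtain ⟨m, x, rfl⟩ := Submodule.fg_iff_exists_fin_generating_family.1 hI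
  refine hne ((Ideal.eq_top_iff_one _).2 ?_)
  let f : R →ₗ[R] (Fin m → R) := LinearMap.toSpanSingleton R _ fun i => (x i).unop
  have hf : Function.Injective f := by
    refine (injective_iff_map_eq_zero f).2 fun r hr => ?_
    have : r ∈ leftAnnihilator (Submodule.span Rᵐᵒᵖ (Set.range x)) := by
      intro z hz
      obtain ⟨c, rfl⟩ := (Submodule.mem_span_range_iff_exists_fun _).1 hz
      have hr' : ∀ i, r * (x i).unop = 0 := fun i => congrFun hr i
      simp [Finset.mul_sum, ← mul_assoc, hr']
    rwa [hann] at this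
  let C : ModuleCat.{u} R := ModuleCat.of R ((Fin m → R) ⧸ LinearMap.range f)
  let g : (Fin m → R) →ₗ[R] C := (LinearMap.range f).mkQ
  have hg : Function.Surjective g := Submodule.mkQ_surjective _
  have hfg : Function.Exact f g := LinearMap.exact_map_mkQ_range f
  have hS : (ShortComplex.mk (ModuleCat.ofHom f) (ModuleCat.ofHom g)
      (by ext1; exact hfg.linearMap_comp_eq_zero)).ShortExact :=
    ModuleCat.shortComplex_shortExact _ hfg hf hg
  have hC : FP R n d C := by
    constructor
    · exact finitelyPresented_of_exact n (A := ModuleCat.of R R)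
        (B := ModuleCat.of R (Fin m → R)) f g hf hfg hg
    · have : Projective (ModuleCat.of R R) := (projective_iff _).1
        (inferInstanceAs (Module.Projective R R))
      have : Projective (ModuleCat.of R (Fin m → R)) := (projective_iff _).1
        (inferInstanceAs (Module.Projective R (Fin m → R)))
      have h1 : HasProjectiveDimensionLT C 2 := hS.hasProjectiveDimensionLT_X₃ 1
        (inferInstanceAs (HasProjectiveDimensionLT (ModuleCat.of R R) 1))
        (inferInstanceAs (HasProjectiveDimensionLT (ModuleCat.of R (Fin m → R)) (1 + 1)))
      -- The resolution of `C` has length one, whence the need for `1 ≤ d`.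
      exact ((projectiveDimension_le_iff C 1).2 h1).trans (WithBot.coe_le_coe.2 hd)
  have := smallProj_eq_FP_iff.1 h C hC
  obtain ⟨s, hs⟩ := Module.projective_lifting_property g LinearMap.id hg
  obtain ⟨-, l, hl⟩ := (hfg.split_tfae'.out 0 1 rfl rfl).1 ⟨hf, s, hs⟩
  -- The coefficients are the values of the retraction `l` on the standard basis, since `1 = l (f
  -- 1)`.
  refine (Submodule.mem_span_range_iff_exists_fun _).2
    ⟨fun i => MulOpposite.op (l fun j => if i = j then 1 else 0), ?_⟩
  have h1 : l (f 1) = 1 := LinearMap.congr_fun hl 1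
  rw [LinearMap.pi_apply_eq_sum_univ l (f 1)] at h1
  apply MulOpposite.unop_injective
  simpa [f] using h1

/-- The bound `m` is separate from `d`: it drops in the induction, while the class `FP R n d` to
which coherence applies stays fixed. -/
theorem projective_of_annihilatorCondition {n : ℕ} {d : ℕ∞} (hR : IsLeftCoherent R n d)
    (h : AnnihilatorCondition R) (m : ℕ) {K : ModuleCat.{u} R} (hK : FP R n d K)
    (hm : HasProjectiveDimensionLE K m) : Module.Projective R K := by
  induction m generalizing K with
  | zero => exact (projective_iff K).2 ((projective_iff_hasProjectiveDimensionLE_zero K).2 hm)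
  | succ m ih =>
    obtain ⟨P, p, _, _, hp, hker⟩ := exists_syzygy hR hK
    have : Module.Finite R (LinearMap.ker p) := finite_of_FP hker
    have : Module.Projective R (LinearMap.ker p) := ih hker (hasProjectiveDimensionLE_ker p hp m)
    obtain ⟨l, hl⟩ := splitsIntoProjectives_of_annihilator h (LinearMap.ker p) P
      (LinearMap.ker p).subtype (Submodule.injective_subtype _)
    obtain ⟨-, s, hs⟩ := ((LinearMap.exact_subtype_ker_map p).split_tfae'.out 0 1 rfl rfl).2 ⟨hp, l, hl⟩
    exact .of_split s p hs

theorem smallProj_eq_FP_of_annihilatorCondition {n : ℕ} {d : ℕ∞} (hR : IsLeftCoherent R n d)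
    (hd : d ≠ ⊤) (h : AnnihilatorCondition R) : smallProj R = FP R n d := by
  refine smallProj_eq_FP_iff.2 fun K hK => ?_
  lift d to ℕ using hd
  exact projective_of_annihilatorCondition hR h d hK ((projDimLE_natCast_iff d K).1 hK.2)

end BoundedFP

theorem mainTheorem7 (R : Type u) [Ring R] (n : ℕ) (d : ℕ∞) (hn : 1 ≤ n) (hd : 1 ≤ d)
    (hR : BoundedFP.IsLeftCoherent R n d) :
    (d ≠ ⊤ → List.TFAE [
      BoundedFP.FPProj R n d ≤ BoundedFP.FPInj R n d,
      BoundedFP.FPInj R n d = ⊤,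
      ∀ X Y : ModuleCat.{u} R, BoundedFP.FPProj R n d X → BoundedFP.FPProj R n d Y →
        Subsingleton (Abelian.Ext.{u} X Y 1),
      BoundedFP.bigProj R = BoundedFP.FPProj R n d,
      BoundedFP.smallProj R = BoundedFP.FP R n d,
      BoundedFP.AnnihilatorCondition R]) ∧
    (d = ⊤ → List.TFAE [
      BoundedFP.FPProj R n d ≤ BoundedFP.FPInj R n d,
      BoundedFP.FPInj R n d = ⊤,
      ∀ X Y : ModuleCat.{u} R, BoundedFP.FPProj R n d X → BoundedFP.FPProj R n d Y →
        Subsingleton (Abelian.Ext.{u} X Y 1),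
      BoundedFP.bigProj R = BoundedFP.FPProj R n d,
      BoundedFP.smallProj R = BoundedFP.FP R n d] ∧
      (BoundedFP.smallProj R = BoundedFP.FP R n d → BoundedFP.AnnihilatorCondition R)) := by
  have ab : BoundedFP.FPProj R n d ≤ BoundedFP.FPInj R n d ↔ BoundedFP.FPInj R n d = ⊤ :=
    ⟨fun h => BoundedFP.FPInj_eq_top_iff.2 (BoundedFP.smallProj_eq_FP_of_FPProj_le_FPInj hR h),
      fun h => h ▸ le_top⟩
  have ac := BoundedFP.FPProj_le_FPInj_iff (R := R) (n := n) (d := d)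
  have db := BoundedFP.bigProj_eq_FPProj_iff (R := R) (n := n) (d := d)
  have be := BoundedFP.FPInj_eq_top_iff (R := R) (n := n) (d := d)
  have ef := BoundedFP.annihilatorCondition_of_smallProj_eq_FP (R := R) (n := n) hd
  refine ⟨fun hfin => ?_, fun _ => ⟨?_, ef⟩⟩
  · have fe := BoundedFP.smallProj_eq_FP_of_annihilatorCondition hR hfin
    tfae_have 1 ↔ 2 := ab
    tfae_have 1 ↔ 3 := ac
    tfae_have 4 ↔ 2 := db
    tfae_have 2 ↔ 5 := be
    tfae_have 5 ↔ 6 := ⟨ef, fe⟩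
    tfae_finish
  · tfae_have 1 ↔ 2 := ab
    tfae_have 1 ↔ 3 := ac
    tfae_have 4 ↔ 2 := db
    tfae_have 2 ↔ 5 := be
    tfae_finish
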